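/- Let $G$ be a semigroup with identity and let $k$ be a $G$-field, i.e. a field with a homomorphism of semigroups with identity from $G$ to the ring endomorphisms of $k$. A $k$-$G$-algebra is a commutative $k$-algebra $R$ with an action of $G$ by ring endomorphisms $T_R(g)$ such that $k\to R$ is $G$-equivariant. A group $k$-$G$-scheme $H$ is a representable functor from $k$-$G$-algebras to groups; its representing algebra is denoted $k\{H\}$, and $H$ is called $G$-algebraic if $k\{H\}$ is generated as a $k$-algebra by $\{T(g)(s) : g\in G,\ s\in S\}$ for some finite set $S\subset k\{H\}$. A representation of $H$ is a finite-dimensional $k$-vector space $V$ together with a morphism $\phi\colon H\to \mathrm{GL}(V)$ of group functors on $k$-$G$-algebras, where $\mathrm{GL}(V)(R)=\mathrm{Aut}_R(V\otimes_k R)$; morphisms of representations are the $H$-equivariant $k$-linear maps, and $\mathrm{Rep}(H)$ denotes the resulting category. With $n=\dim V$, the functor $\mathrm{GL}(V)$ is represented by the $k$-$G$-algebra $k\{\mathrm{GL}(V)\}=k\{x_{11},\dots,x_{nn},1/\det(x_{ij})\}_G$, that is, the polynomial ring in the variables $x_{ij,g}$ $(1\le i,j\le n,\ g\in G)$ with all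 $\det(x_{ij,g})$, $g\in G$, inverted, where $h\in G$ acts on the coefficients and by $x_{ij,g}\mapsto x_{ij,hg}$; the representation is called faithful if the dual morphism $\phi^*\colon k\{\mathrm{GL}(V)\}\to k\{H\}$ is surjective. For $g\in G$, $T(g)(V)={}^gV$ denotes the representation of $H$ on the base extension of $V$ along $g\colon k\to k$ on which $h\in H(R)$ acts by the base extension of $\phi(h)$ along $T_R(g)\colon R\to R$ (if $h$ acts on $V\otimes_k R$ by the matrix $A$ in a basis of $V$, it acts on ${}^gV\otimes_k R$ by the matrix $T_R(g)(A)$). **Theorem.** Let $H$ be a $G$-algebraic group over $k$ and let $V$ be a faithful representation of $H$. Then $V$ is a $G$-$\otimes$-generator of $\mathrm{Rep}(H)$: the objects $T(g)(V)$, $g\in G$, generate $\mathrm{Rep}(H)$ as a tensor category. Explicitly, every representation of $H$ is isomorphic to a subquotient of a representation obtained from the trivial representation $k$ and the representations $T(g)(V)$, $g\in G$, by finitely many tensor products, direct sums and duals. -/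

import Mathlib

open CategoryTheory TensorProduct

universe u

namespace DiffTannaka

noncomputable section

/-! ### `k`-`G`-algebras

`G` is a semigroup with identity (a monoid) and a `G`-field is a field `k` with a homomorphism
`σ : G →* (k →+* k)` to the monoid of ring endomorphisms of `k`. -/

/-- A `k`-`G`-algebra: a commutative `k`-algebra with an action `T` of `G` by ring endomorphisms
such that `k → R` commutes with the actions of `G`. -/
structure GAlg {G k : Type u} [Monoid G] [Field k] (σ : G →* (k →+* k)) : Type (u + 1) where
  carrier : Type u
  [commRing : CommRing carrier]
  [algebra : Algebra k carrier]
  T : G →* (carrier →+* carrier)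
  T_algebraMap : ∀ (g : G) (a : k), T g (algebraMap k carrier a) = algebraMap k carrier (σ g a)

attribute [instance] GAlg.commRing GAlg.algebra

instance {G k : Type u} [Monoid G] [Field k] (σ : G →* (k →+* k)) :
    CoeSort (GAlg σ) (Type u) := ⟨GAlg.carrier⟩

/-- A morphism of `k`-`G`-algebras. -/
@[ext]
structure GAlg.Hom {G k : Type u} [Monoid G] [Field k] {σ : G →* (k →+* k)}
    (R S : GAlg σ) : Type u where
  toAlgHom : R →ₐ[k] S
  comm : ∀ (g : G) (a : R), toAlgHom (R.T g a) = S.T g (toAlgHom a)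

instance {G k : Type u} [Monoid G] [Field k] (σ : G →* (k →+* k)) : Category.{u} (GAlg σ) where
  Hom R S := GAlg.Hom R S
  id R := ⟨AlgHom.id k R, fun _ _ => rfl⟩
  comp f g := ⟨g.toAlgHom.comp f.toAlgHom, fun h a => by simp [f.comm, g.comm]⟩

/-- A `k`-`G`-algebra is finitely generated if there is a finite set `S` such that it is generated
as a `k`-algebra by all `T(g)(s)`, `g ∈ G`, `s ∈ S`. -/
def GAlg.FinitelyGenerated {G k : Type u} [Monoid G] [Field k] {σ : G →* (k →+* k)}
    (R : GAlg σ) : Prop :=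
  ∃ S : Finset R, Algebra.adjoin k {a : R | ∃ g : G, ∃ s ∈ S, a = R.T g s} = ⊤

/-! ### Group `k`-`G`-schemes -/

/-- A group `k`-`G`-scheme `H`: a functor from `k`-`G`-algebras to groups which is represented by a
`k`-`G`-algebra `k{H}`. -/
structure GroupScheme {G k : Type u} [Monoid G] [Field k] (σ : G →* (k →+* k)) :
    Type (u + 1) where
  points : GAlg σ ⥤ GrpCat.{u}
  coordRing : GAlg σ
  repr : (points ⋙ forget GrpCat.{u}).CorepresentableBy coordRing

/-- `H` is a `G`-algebraic group if `k{H}` is a finitely generated `k`-`G`-algebra. -/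
def GroupScheme.IsGAlgebraic {G k : Type u} [Monoid G] [Field k] {σ : G →* (k →+* k)}
    (H : GroupScheme σ) : Prop :=
  H.coordRing.FinitelyGenerated

/-- The universal point of `H`, in `H(k{H})`. -/
def GroupScheme.univPoint {G k : Type u} [Monoid G] [Field k] {σ : G →* (k →+* k)}
    (H : GroupScheme σ) : H.points.obj H.coordRing :=
  H.repr.homEquiv (𝟙 H.coordRing)

/-! ### Representations -/

/-- The map `f ⊗ id : R ⊗ V → S ⊗ V` for a morphism `f : R → S` of `k`-`G`-algebras. -/
def scalarMap {G k : Type u} [Monoid G] [Field k] {σ : G →* (k →+* k)} {R S : GAlg σ}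
    (f : R ⟶ S) (V : Type u) [AddCommGroup V] [Module k V] : R ⊗[k] V →ₗ[k] S ⊗[k] V :=
  (GAlg.Hom.toAlgHom f).toLinearMap.rTensor V

@[simp]
lemma scalarMap_tmul {G k : Type u} [Monoid G] [Field k] {σ : G →* (k →+* k)} {R S : GAlg σ}
    (f : R ⟶ S) {V : Type u} [AddCommGroup V] [Module k V] (r : R) (v : V) :
    scalarMap f V (r ⊗ₜ v) = (GAlg.Hom.toAlgHom f r) ⊗ₜ v := rfl

/-- A representation of `H`: a finite-dimensional `k`-vector space `V` and a morphism of group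
functors `H → GL(V)`, that is, for each `k`-`G`-algebra `R` an `R`-linear action of the group
`H(R)` on `R ⊗ V`, naturally in `R`. -/
structure Rep {G k : Type u} [Monoid G] [Field k] {σ : G →* (k →+* k)}
    (H : GroupScheme σ) : Type (u + 1) where
  V : Type u
  [addCommGroup : AddCommGroup V]
  [module : Module k V]
  [finite : FiniteDimensional k V]
  ρ : ∀ R : GAlg σ, Representation R (H.points.obj R) (R ⊗[k] V)
  natural : ∀ {R S : GAlg σ} (f : R ⟶ S) (h : H.points.obj R) (x : R ⊗[k] V),
    scalarMap f V (ρ R h x) = ρ S (H.points.map f h) (scalarMap f V x)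

attribute [instance] Rep.addCommGroup Rep.module Rep.finite

/-- A morphism of representations: a `k`-linear `H`-equivariant map. -/
structure Rep.Hom {G k : Type u} [Monoid G] [Field k] {σ : G →* (k →+* k)}
    {H : GroupScheme σ} (X Y : Rep H) : Type u where
  toLinearMap : X.V →ₗ[k] Y.V
  equivariant : ∀ (R : GAlg σ) (h : H.points.obj R) (x : R ⊗[k] X.V),
    toLinearMap.baseChange R (X.ρ R h x) = Y.ρ R h (toLinearMap.baseChange R x)

/-! ### Unit, tensor product, direct sum and dual -/

/-- Transport of a representation along a linear isomorphism. -/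
def transport {R Γ M N : Type u} [CommRing R] [Monoid Γ] [AddCommMonoid M] [AddCommMonoid N]
    [Module R M] [Module R N] (e : M ≃ₗ[R] N) (ρ : Representation R Γ N) :
    Representation R Γ M :=
  (e.symm.conjRingEquiv.toMulEquiv.toMonoidHom).comp ρ

@[simp]
lemma transport_apply {R Γ M N : Type u} [CommRing R] [Monoid Γ] [AddCommMonoid M]
    [AddCommMonoid N] [Module R M] [Module R N] (e : M ≃ₗ[R] N) (ρ : Representation R Γ N)
    (γ : Γ) (x : M) : transport e ρ γ x = e.symm (ρ γ (e x)) := rfl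

/-- The unit object: `k` with the trivial action. -/
def Rep.unit {G k : Type u} [Monoid G] [Field k] {σ : G →* (k →+* k)}
    (H : GroupScheme σ) : Rep H where
  V := k
  ρ R := Representation.trivial R (H.points.obj R) (R ⊗[k] k)
  natural f h x := by simp

/-- The tensor product of representations, acting through
`R ⊗ (V ⊗ W) ≃ (R ⊗ V) ⊗_R (R ⊗ W)`. -/
def Rep.tensor {G k : Type u} [Monoid G] [Field k] {σ : G →* (k →+* k)}
    {H : GroupScheme σ} (X Y : Rep H) : Rep H where
  V := X.V ⊗[k] Y.V
  ρ R := transport (AlgebraTensorModule.distribBaseChange k R X.V Y.V) ((X.ρ R).tprod (Y.ρ R))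
  natural {R S} f h x := by
    have key : ∀ (a : R ⊗[k] X.V) (b : R ⊗[k] Y.V),
        scalarMap f (X.V ⊗[k] Y.V)
          ((AlgebraTensorModule.distribBaseChange k R X.V Y.V).symm (a ⊗ₜ b)) =
        (AlgebraTensorModule.distribBaseChange k S X.V Y.V).symm
          (scalarMap f X.V a ⊗ₜ scalarMap f Y.V b) := by
      intro a b
      induction a using TensorProduct.induction_on with
      | zero => simp
      | add a a' ha ha' => simp only [TensorProduct.add_tmul, map_add, ha, ha']
      | tmul r v =>
        induction b using TensorProduct.induction_on with
        | zero => simp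
        | add b b' hb hb' => simp only [TensorProduct.tmul_add, map_add, hb, hb']
        | tmul r' w => simp
    induction x using TensorProduct.induction_on with
    | zero => simp
    | add x y hx hy => simp only [map_add, hx, hy]
    | tmul r z =>
      induction z using TensorProduct.induction_on with
      | zero => simp
      | add x y hx hy => simp only [TensorProduct.tmul_add, map_add, hx, hy]
      | tmul v w =>
        simp only [transport_apply, AlgebraTensorModule.distribBaseChange_tmul,
          Representation.tprod_apply, TensorProduct.map_tmul, scalarMap_tmul]
        rw [key, X.natural, Y.natural]
        simp

/-- The direct sum of representations, acting through `R ⊗ (V × W) ≃ (R ⊗ V) × (R ⊗ W)`. -/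
def Rep.directSum {G k : Type u} [Monoid G] [Field k] {σ : G →* (k →+* k)}
    {H : GroupScheme σ} (X Y : Rep H) : Rep H where
  V := X.V × Y.V
  ρ R := transport (TensorProduct.prodRight k R R X.V Y.V) ((X.ρ R).prod (Y.ρ R))
  natural {R S} f h x := by
    have key1 : ∀ z, TensorProduct.prodRight k S S X.V Y.V (scalarMap f (X.V × Y.V) z) =
        (scalarMap f X.V (TensorProduct.prodRight k R R X.V Y.V z).1,
          scalarMap f Y.V (TensorProduct.prodRight k R R X.V Y.V z).2) := by
      intro z
      induction z using TensorProduct.induction_on with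
      | zero => ext <;> simp
      | add x y hx hy => ext <;> simp [hx, hy]
      | tmul r z => simp
    apply (TensorProduct.prodRight k S S X.V Y.V).injective
    rw [key1]
    simp only [transport_apply, LinearEquiv.apply_symm_apply]
    rw [key1]
    simp [X.natural, Y.natural]

/-- The canonical isomorphism `R ⊗ V^∨ ≃ (R ⊗ V)^∨`. -/
def dualEquiv {k : Type u} [Field k] (R : Type u) [CommRing R] [Algebra k R] (V : Type u)
    [AddCommGroup V] [Module k V] [FiniteDimensional k V] :
    R ⊗[k] Module.Dual k V ≃ₗ[R] Module.Dual R (R ⊗[k] V) :=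
  (TensorProduct.isBaseChange k V R).toDualBaseChange

lemma dualEquiv_tmul_tmul {k : Type u} [Field k] (R : Type u) [CommRing R] [Algebra k R]
    (V : Type u) [AddCommGroup V] [Module k V] [FiniteDimensional k V]
    (r s : R) (l : Module.Dual k V) (v : V) :
    dualEquiv R V (r ⊗ₜ l) (s ⊗ₜ v) = r * s * algebraMap k R (l v) := by
  have h := (TensorProduct.isBaseChange k V R).toDualBaseChange_tmul r l v
  have h2 : (s ⊗ₜ[k] v : R ⊗[k] V) = s • ((TensorProduct.mk k R V 1) v) := by
    simp [TensorProduct.smul_tmul']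
  rw [h2, map_smul]
  unfold dualEquiv
  rw [h, smul_eq_mul]
  ring

/-- The dual representation: `h` acts on `R ⊗ V^∨ ≃ (R ⊗ V)^∨` by `l ↦ l ∘ h⁻¹`. -/
def Rep.dual {G k : Type u} [Monoid G] [Field k] {σ : G →* (k →+* k)}
    {H : GroupScheme σ} (X : Rep H) : Rep H where
  V := Module.Dual k X.V
  ρ R := transport (dualEquiv R X.V) (X.ρ R).dual
  natural {R S} f h x := by
    have key : ∀ (z : R ⊗[k] Module.Dual k X.V) (y : R ⊗[k] X.V),
        dualEquiv S X.V (scalarMap f _ z) (scalarMap f _ y) =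
          GAlg.Hom.toAlgHom f (dualEquiv R X.V z y) := by
      intro z y
      induction z using TensorProduct.induction_on with
      | zero => simp
      | add x y hx hy => simp only [map_add, LinearMap.add_apply, hx, hy]
      | tmul r l =>
        induction y using TensorProduct.induction_on with
        | zero => simp
        | add x y hx hy => simp only [map_add, hx, hy]
        | tmul s v => simp [dualEquiv_tmul_tmul]
    apply (dualEquiv S X.V).injective
    apply LinearMap.ext
    intro y
    induction y using TensorProduct.induction_on with
    | zero => simp
    | add x y hx hy => simp only [map_add, hx, hy]
    | tmul s v =>
      have h2 : (s ⊗ₜ[k] v : S ⊗[k] X.V) = s • scalarMap f X.V (1 ⊗ₜ v) := by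
        simp [TensorProduct.smul_tmul']
      rw [h2, map_smul, map_smul]
      congr 1
      rw [key]
      simp only [transport_apply, LinearEquiv.apply_symm_apply, Representation.dual_apply,
        Module.Dual.transpose_apply]
      rw [← map_inv, LinearMap.comp_apply, LinearMap.comp_apply, ← X.natural, key]

/-! ### The action of `G` -/

/-- The field `k`, regarded as a `k`-algebra through the endomorphism `s`. -/
def TwistScalar {k : Type u} [Field k] (_s : k →+* k) : Type u := k

instance {k : Type u} [Field k] (s : k →+* k) : Field (TwistScalar s) := inferInstanceAs (Field k)

instance {k : Type u} [Field k] (s : k →+* k) : Algebra k (TwistScalar s) :=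
  RingHom.toAlgebra (S := TwistScalar s) s

/-- The base extension of the `k`-vector space `V` along the endomorphism `s` of `k`. -/
def Twist {k : Type u} [Field k] (s : k →+* k) (V : Type u) [AddCommGroup V] [Module k V] :
    Type u := TwistScalar s ⊗[k] V

instance {k : Type u} [Field k] (s : k →+* k) (V : Type u) [AddCommGroup V] [Module k V] :
    AddCommGroup (Twist s V) := inferInstanceAs (AddCommGroup (TwistScalar s ⊗[k] V))

/-- `k` acts on the scalar factor by multiplication: `b • (a ⊗ v) = (b * a) ⊗ v`. -/
instance {k : Type u} [Field k] (s : k →+* k) (V : Type u) [AddCommGroup V] [Module k V] :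
    Module k (Twist s V) := inferInstanceAs (Module (TwistScalar s) (TwistScalar s ⊗[k] V))

instance {k : Type u} [Field k] (s : k →+* k) (V : Type u) [AddCommGroup V] [Module k V]
    [FiniteDimensional k V] : FiniteDimensional k (Twist s V) :=
  inferInstanceAs (Module.Finite (TwistScalar s) (TwistScalar s ⊗[k] V))

/-- The canonical `s`-semilinear map `v ↦ 1 ⊗ v`. -/
def Twist.mk {k : Type u} [Field k] (s : k →+* k) (V : Type u) [AddCommGroup V] [Module k V] :
    V →ₛₗ[s] Twist s V where
  toFun v := (1 : TwistScalar s) ⊗ₜ[k] v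
  map_add' v w := TensorProduct.tmul_add _ v w
  map_smul' a v := by
    change (1 : TwistScalar s) ⊗ₜ[k] (a • v) =
      (show TwistScalar s from s a) • ((1 : TwistScalar s) ⊗ₜ[k] v)
    rw [TensorProduct.tmul_smul, TensorProduct.smul_tmul', TensorProduct.smul_tmul',
      Algebra.smul_def]
    rfl

lemma Twist.induction {k : Type u} [Field k] (s : k →+* k) {V : Type u} [AddCommGroup V]
    [Module k V] {p : Twist s V → Prop} (zero : p 0)
    (smul_mk : ∀ (b : k) (v : V), p (b • Twist.mk s V v))
    (add : ∀ x y, p x → p y → p (x + y)) (x : Twist s V) : p x := by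
  refine TensorProduct.induction_on (motive := p) x zero (fun b v => ?_) add
  have h : (b ⊗ₜ[k] v : TwistScalar s ⊗[k] V) = b • ((1 : TwistScalar s) ⊗ₜ[k] v) := by
    rw [TensorProduct.smul_tmul', smul_eq_mul, mul_one]
  rw [h]
  exact smul_mk b v

/-- The identity of `k`, as an isomorphism of rings `TwistScalar s ≃ k`. -/
def TwistScalar.equiv {k : Type u} [Field k] (s : k →+* k) : TwistScalar s ≃+* k := RingEquiv.refl k

lemma TwistScalar.equiv_smul {k : Type u} [Field k] (s : k →+* k) (a : k) (b : TwistScalar s) :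
    TwistScalar.equiv s (a • b) = s a * TwistScalar.equiv s b := rfl

/-- The additive map `b ⊗ v ↦ b • f v` attached to an `s`-semilinear map `f : V → M`. -/
def Twist.liftAdd {k : Type u} [Field k] (s : k →+* k) {V M : Type u} [AddCommGroup V] [Module k V]
    [AddCommGroup M] [Module k M] (f : V →ₛₗ[s] M) : TwistScalar s ⊗[k] V →+ M :=
  TensorProduct.liftAddHom
    (((smulAddHom k M).comp (TwistScalar.equiv s).toAddMonoidHom).compl₂ f.toAddMonoidHom) (by
      intro a b v
      change TwistScalar.equiv s (a • b) • f v = TwistScalar.equiv s b • f (a • v)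
      rw [map_smulₛₗ f a v, smul_smul, mul_comm, TwistScalar.equiv_smul])

lemma Twist.liftAdd_tmul {k : Type u} [Field k] (s : k →+* k) {V M : Type u} [AddCommGroup V]
    [Module k V] [AddCommGroup M] [Module k M] (f : V →ₛₗ[s] M) (b : TwistScalar s) (v : V) :
    Twist.liftAdd s f (b ⊗ₜ v) = TwistScalar.equiv s b • f v := rfl

/-- The universal property of the base extension: an `s`-semilinear map `f : V → M` extends to the
`k`-linear map `b ⊗ v ↦ b • f v`. -/
def Twist.lift {k : Type u} [Field k] (s : k →+* k) {V M : Type u} [AddCommGroup V] [Module k V]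
    [AddCommGroup M] [Module k M] (f : V →ₛₗ[s] M) : Twist s V →ₗ[k] M where
  toFun := Twist.liftAdd s f
  map_add' := map_add _
  map_smul' b x := by
    change Twist.liftAdd s f
      (((TwistScalar.equiv s).symm b) • (show TwistScalar s ⊗[k] V from x)) = b • _
    refine TensorProduct.induction_on (motive := fun x : TwistScalar s ⊗[k] V =>
      Twist.liftAdd s f (((TwistScalar.equiv s).symm b) • x) = b • Twist.liftAdd s f x) x
      ?_ (fun a v => ?_) (fun x y hx hy => ?_)
    · simp
    · rw [TensorProduct.smul_tmul', Twist.liftAdd_tmul, Twist.liftAdd_tmul, smul_eq_mul, map_mul,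
        RingEquiv.apply_symm_apply, mul_smul]
    · rw [smul_add, map_add, map_add, smul_add, hx, hy]

@[simp]
lemma Twist.lift_mk {k : Type u} [Field k] (s : k →+* k) {V M : Type u} [AddCommGroup V]
    [Module k V] [AddCommGroup M] [Module k M] (f : V →ₛₗ[s] M) (v : V) :
    Twist.lift s f (Twist.mk s V v) = f v := one_smul k (f v)

/-- The additive map `R ⊗ V → R ⊗ ᵍV`, `r ⊗ v ↦ g(r) ⊗ (1 ⊗ v)`. -/
def twistMap {G k : Type u} [Monoid G] [Field k] {σ : G →* (k →+* k)} (g : G) (R : GAlg σ)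
    (V : Type u) [AddCommGroup V] [Module k V] : R ⊗[k] V →+ R ⊗[k] Twist (σ g) V :=
  TensorProduct.liftAddHom
    (AddMonoidHom.mk' (fun r => AddMonoidHom.mk'
      (fun v => R.T g r ⊗ₜ[k] Twist.mk (σ g) V v)
      (fun v w => by rw [map_add, TensorProduct.tmul_add]))
      (fun r s => by ext v; simp [TensorProduct.add_tmul])) (by
      intro a r v
      change R.T g (a • r) ⊗ₜ[k] Twist.mk (σ g) V v = R.T g r ⊗ₜ[k] Twist.mk (σ g) V (a • v)
      rw [map_smulₛₗ (Twist.mk (σ g) V) a v, Algebra.smul_def, map_mul, R.T_algebraMap, ← Algebra.smul_def,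
        TensorProduct.smul_tmul])

@[simp]
lemma twistMap_tmul {G k : Type u} [Monoid G] [Field k] {σ : G →* (k →+* k)} (g : G) (R : GAlg σ)
    {V : Type u} [AddCommGroup V] [Module k V] (r : R) (v : V) :
    twistMap g R V (r ⊗ₜ v) = R.T g r ⊗ₜ Twist.mk (σ g) V v := rfl

lemma twistMap_smul {G k : Type u} [Monoid G] [Field k] {σ : G →* (k →+* k)} (g : G) (R : GAlg σ)
    {V : Type u} [AddCommGroup V] [Module k V] (r : R) (x : R ⊗[k] V) :
    twistMap g R V (r • x) = R.T g r • twistMap g R V x := by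
  induction x using TensorProduct.induction_on with
  | zero => simp
  | add x y hx hy => simp only [smul_add, map_add, hx, hy]
  | tmul s v => simp [TensorProduct.smul_tmul']

/-- For an `R`-linear endomorphism `h` of `R ⊗ V`, the `R`-linear endomorphism `g(h)` of `R ⊗ ᵍV`
obtained from `h` by base extension along `g : R → R`: it is determined by
`g(h) (1 ⊗ (1 ⊗ v)) = τ (h (1 ⊗ v))`, where `τ (r ⊗ w) = g(r) ⊗ (1 ⊗ w)`. -/
def twistEnd {G k : Type u} [Monoid G] [Field k] {σ : G →* (k →+* k)} (g : G) (R : GAlg σ)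
    (V : Type u) [AddCommGroup V] [Module k V] (h : Module.End R (R ⊗[k] V)) :
    Module.End R (R ⊗[k] Twist (σ g) V) :=
  LinearMap.liftBaseChange R (Twist.lift (σ g)
    { toFun := fun v => twistMap g R V (h (1 ⊗ₜ v))
      map_add' := fun v w => by simp [TensorProduct.tmul_add]
      map_smul' := fun a v => by
        have e : (1 : R) ⊗ₜ[k] (a • v) = algebraMap k R a • ((1 : R) ⊗ₜ[k] v) := by
          rw [algebraMap_smul, TensorProduct.tmul_smul]
        rw [e, map_smul, twistMap_smul, R.T_algebraMap, algebraMap_smul] })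

lemma twistEnd_mk {G k : Type u} [Monoid G] [Field k] {σ : G →* (k →+* k)} (g : G) (R : GAlg σ)
    (V : Type u) [AddCommGroup V] [Module k V] (h : Module.End R (R ⊗[k] V)) (v : V) :
    twistEnd g R V h (1 ⊗ₜ Twist.mk (σ g) V v) = twistMap g R V (h (1 ⊗ₜ v)) := by
  simp [twistEnd]

lemma twistEnd_twistMap {G k : Type u} [Monoid G] [Field k] {σ : G →* (k →+* k)} (g : G)
    (R : GAlg σ) (V : Type u) [AddCommGroup V] [Module k V] (h : Module.End R (R ⊗[k] V))
    (x : R ⊗[k] V) : twistEnd g R V h (twistMap g R V x) = twistMap g R V (h x) := by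
  induction x using TensorProduct.induction_on with
  | zero => simp
  | add x y hx hy => simp only [map_add, hx, hy]
  | tmul r v =>
    have e : r ⊗ₜ[k] v = r • ((1 : R) ⊗ₜ[k] v) := by simp [TensorProduct.smul_tmul']
    rw [e, twistMap_smul, map_smul, map_smul, twistMap_smul, twistMap_tmul, map_one, twistEnd_mk]

lemma twist_ext {G k : Type u} [Monoid G] [Field k] {σ : G →* (k →+* k)} {g : G}
    {R : GAlg σ} {V : Type u} [AddCommGroup V] [Module k V] {p : R ⊗[k] Twist (σ g) V → Prop}
    (zero : p 0) (smul_mk : ∀ (r : R) (v : V), p (r • (1 ⊗ₜ Twist.mk (σ g) V v)))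
    (add : ∀ x y, p x → p y → p (x + y)) (x : R ⊗[k] Twist (σ g) V) : p x := by
  induction x using TensorProduct.induction_on with
  | zero => exact zero
  | add x y hx hy => exact add x y hx hy
  | tmul r w =>
    induction w using Twist.induction with
    | zero => simpa using zero
    | add x y hx hy => rw [TensorProduct.tmul_add]; exact add _ _ hx hy
    | smul_mk b v =>
      have e : r ⊗ₜ[k] (b • Twist.mk (σ g) V v) = (b • r) • ((1 : R) ⊗ₜ[k] Twist.mk (σ g) V v) := by
        rw [← TensorProduct.smul_tmul, TensorProduct.smul_tmul', smul_eq_mul, mul_one]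
      rw [e]
      exact smul_mk _ v

/-- The representation `T(g)(X) = ᵍX`: the space is the base extension of `V` along
`g : k → k`, on which `h ∈ H(R)` acts as `g(h)`. -/
def Rep.twist {G k : Type u} [Monoid G] [Field k] {σ : G →* (k →+* k)}
    {H : GroupScheme σ} (g : G) (X : Rep H) : Rep H where
  V := Twist (σ g) X.V
  ρ R :=
    { toFun := fun h => twistEnd g R X.V (X.ρ R h)
      map_one' := by
        apply LinearMap.ext
        intro x
        induction x using twist_ext with
        | zero => simp
        | add x y hx hy => simp only [map_add, hx, hy]
        | smul_mk r v => rw [map_smul, twistEnd_mk]; simp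
      map_mul' := fun h h' => by
        apply LinearMap.ext
        intro x
        induction x using twist_ext with
        | zero => simp
        | add x y hx hy => simp only [map_add, hx, hy]
        | smul_mk r v =>
          rw [map_smul, twistEnd_mk, map_smul, Module.End.mul_apply, twistEnd_mk, twistEnd_twistMap,
            map_mul, Module.End.mul_apply] }
  natural {R S} f h x := by
    have key : ∀ z : R ⊗[k] X.V, scalarMap f _ (twistMap g R X.V z) =
        twistMap g S X.V (scalarMap f X.V z) := by
      intro z
      induction z using TensorProduct.induction_on with
      | zero => simp
      | add x y hx hy => simp only [map_add, hx, hy]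
      | tmul r v => simp [GAlg.Hom.comm]
    have semi : ∀ {W : Type u} [AddCommGroup W] [Module k W] (r : R) (z : R ⊗[k] W),
        scalarMap f W (r • z) = GAlg.Hom.toAlgHom f r • scalarMap f W z := by
      intro W _ _ r z
      induction z using TensorProduct.induction_on with
      | zero => simp
      | add x y hx hy => simp only [smul_add, map_add, hx, hy]
      | tmul r v => simp [TensorProduct.smul_tmul']
    change scalarMap f _ (twistEnd g R X.V (X.ρ R h) x) =
      twistEnd g S X.V (X.ρ S (H.points.map f h)) (scalarMap f _ x)
    induction x using twist_ext with
    | zero => simp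
    | add x y hx hy => simp only [map_add, hx, hy]
    | smul_mk r v =>
      rw [map_smul, twistEnd_mk, semi, semi, map_smul, key, X.natural, scalarMap_tmul,
        scalarMap_tmul, map_one, twistEnd_mk]

/-! ### The coordinate ring of `GL_n` and faithful representations -/

/-- The ring of `G`-polynomials `k{x₁₁, …, xₙₙ}_G`: polynomials in variables `x_{ij,g}`. -/
abbrev GPoly (G k : Type u) [Monoid G] [Field k] (n : ℕ) : Type u :=
  MvPolynomial (Fin n × Fin n × G) k

/-- The action of `h ∈ G` on `G`-polynomials: `h` on the coefficients and `x_{ij,g} ↦ x_{ij,hg}`. -/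
def GPoly.T {G k : Type u} [Monoid G] [Field k] (σ : G →* (k →+* k)) (n : ℕ) (h : G) :
    GPoly G k n →+* GPoly G k n :=
  MvPolynomial.eval₂Hom (MvPolynomial.C.comp (σ h))
    (fun p => MvPolynomial.X (p.1, p.2.1, h * p.2.2))

/-- `g(det) = det (x_{ij,g})`. -/
def GPoly.det (G k : Type u) [Monoid G] [Field k] (n : ℕ) (g : G) : GPoly G k n :=
  (Matrix.of fun i j : Fin n => (MvPolynomial.X (i, j, g) : GPoly G k n)).det

lemma GPoly.T_det {G k : Type u} [Monoid G] [Field k] (σ : G →* (k →+* k)) (n : ℕ) (h g : G) :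
    GPoly.T σ n h (GPoly.det G k n g) = GPoly.det G k n (h * g) := by
  unfold GPoly.det
  rw [RingHom.map_det]
  congr 1
  ext1 i j
  simp [GPoly.T]

/-- The multiplicative set generated by all `g(det)`, `g ∈ G`. -/
def GPoly.dets (G k : Type u) [Monoid G] [Field k] (n : ℕ) : Submonoid (GPoly G k n) :=
  Submonoid.closure (Set.range (GPoly.det G k n))

lemma GPoly.dets_le {G k : Type u} [Monoid G] [Field k] (σ : G →* (k →+* k)) (n : ℕ) (h : G) :
    GPoly.dets G k n ≤ (GPoly.dets G k n).comap (GPoly.T σ n h) := by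
  refine (Submonoid.closure_le).2 ?_
  rintro _ ⟨g, rfl⟩
  exact Submonoid.subset_closure ⟨h * g, (GPoly.T_det σ n h g).symm⟩

/-- The ring `k{x₁₁, …, xₙₙ, 1/det}_G`. -/
abbrev GLRing (G k : Type u) [Monoid G] [Field k] (n : ℕ) : Type u :=
  Localization (GPoly.dets G k n)

/-- The action of `h ∈ G` on `k{x₁₁, …, xₙₙ, 1/det}_G`. -/
def GLRing.T {G k : Type u} [Monoid G] [Field k] (σ : G →* (k →+* k)) (n : ℕ) (h : G) :
    GLRing G k n →+* GLRing G k n :=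
  IsLocalization.map (GLRing G k n) (GPoly.T σ n h) (GPoly.dets_le σ n h)

lemma GLRing.algebraMap_eq {G k : Type u} [Monoid G] [Field k] (n : ℕ) (a : k) :
    algebraMap k (GLRing G k n) a = algebraMap (GPoly G k n) (GLRing G k n) (MvPolynomial.C a) :=
  rfl

/-- The `k`-`G`-algebra `k{GL_n} = k{x₁₁, …, xₙₙ, 1/det}_G`. -/
def glAlg {G k : Type u} [Monoid G] [Field k] (σ : G →* (k →+* k)) (n : ℕ) : GAlg σ where
  carrier := GLRing G k n
  T :=
    { toFun := GLRing.T σ n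
      map_one' := by
        apply IsLocalization.ringHom_ext (GPoly.dets G k n)
        apply MvPolynomial.ringHom_ext
        · intro a; simp [GLRing.T, GPoly.T]
        · intro p; simp [GLRing.T, GPoly.T]
      map_mul' := fun g h => by
        apply IsLocalization.ringHom_ext (GPoly.dets G k n)
        apply MvPolynomial.ringHom_ext
        · intro a; simp [GLRing.T, GPoly.T]
        · intro p; simp [GLRing.T, GPoly.T, mul_assoc] }
  T_algebraMap g a := by
    change GLRing.T σ n g (algebraMap k (GLRing G k n) a) = algebraMap k (GLRing G k n) (σ g a)
    rw [GLRing.algebraMap_eq, GLRing.algebraMap_eq]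
    simp [GLRing.T, GPoly.T]

lemma isUnit_of_mem_dets {G k : Type u} [Monoid G] [Field k] {σ : G →* (k →+* k)} {n : ℕ}
    {R : GAlg σ} (M : Matrix.GeneralLinearGroup (Fin n) R) (y : GPoly.dets G k n) :
    IsUnit (MvPolynomial.aeval (R := k)
      (fun p : Fin n × Fin n × G => R.T p.2.2 (M.1 p.1 p.2.1)) (y : GPoly G k n)) := by
  obtain ⟨y, hy⟩ := y
  change IsUnit (MvPolynomial.aeval (R := k)
      (fun p : Fin n × Fin n × G => R.T p.2.2 (M.1 p.1 p.2.1)) y)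
  induction hy using Submonoid.closure_induction with
  | one => simp
  | mul x y _ _ hx hy => rw [map_mul]; exact hx.mul hy
  | mem x hx =>
    obtain ⟨g, rfl⟩ := hx
    have e : MvPolynomial.aeval (R := k)
        (fun p : Fin n × Fin n × G => R.T p.2.2 (M.1 p.1 p.2.1)) (GPoly.det G k n g) =
        R.T g M.1.det := by
      unfold GPoly.det
      rw [AlgHom.map_det, RingHom.map_det]
      congr 1
      ext1 i j
      simp
    rw [e]
    exact (((Matrix.isUnit_iff_isUnit_det M.1).1 M.isUnit)).map (R.T g)

/-- The `k`-algebra morphism `k{GL_n} → R` which maps `x_{ij,g}` to `g(M_{ij})`. -/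
def GLRing.liftPoint {G k : Type u} [Monoid G] [Field k] {σ : G →* (k →+* k)} {n : ℕ}
    {R : GAlg σ} (M : Matrix.GeneralLinearGroup (Fin n) R) : GLRing G k n →ₐ[k] R :=
  IsLocalization.liftAlgHom (M := GPoly.dets G k n) (S := GLRing G k n)
    (f := MvPolynomial.aeval (R := k)
      (fun p : Fin n × Fin n × G => R.T p.2.2 (M.1 p.1 p.2.1)))
    (isUnit_of_mem_dets M)

lemma GLRing.liftPoint_algebraMap {G k : Type u} [Monoid G] [Field k] {σ : G →* (k →+* k)} {n : ℕ}
    {R : GAlg σ} (M : Matrix.GeneralLinearGroup (Fin n) R) (f : GPoly G k n) :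
    GLRing.liftPoint M (algebraMap (GPoly G k n) (GLRing G k n) f) =
      MvPolynomial.aeval (R := k) (fun p : Fin n × Fin n × G => R.T p.2.2 (M.1 p.1 p.2.1)) f :=
  IsLocalization.lift_eq _ f

/-- The morphism `k{GL_n} → R` of `k`-`G`-algebras corresponding to a point `M ∈ GL_n(R)`: it maps
`x_{ij,g}` to `g(M_{ij})`. -/
def glAlg.homOfPoint {G k : Type u} [Monoid G] [Field k] {σ : G →* (k →+* k)} {n : ℕ}
    {R : GAlg σ} (M : Matrix.GeneralLinearGroup (Fin n) R) : glAlg σ n ⟶ R :=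
  GAlg.Hom.mk (R := glAlg σ n) (GLRing.liftPoint M) (by
    intro g a
    have e : (GLRing.liftPoint M).toRingHom.comp (GLRing.T σ n g) =
        (R.T g).comp (GLRing.liftPoint M).toRingHom := by
      apply IsLocalization.ringHom_ext (GPoly.dets G k n)
      apply MvPolynomial.ringHom_ext
      · intro a
        simp [GLRing.T, GPoly.T, GLRing.liftPoint_algebraMap, R.T_algebraMap]
      · intro p
        simp [GLRing.T, GPoly.T, GLRing.liftPoint_algebraMap]
    exact RingHom.congr_fun e a)

/-- The point of `GL_n(k{H})`, `n = dim V`, given by the action of the universal point of `H` in a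
basis `e` of `V`: `h(e_j) = ∑ᵢ M_{ij} e_i`. -/
def Rep.univMatrix {G k : Type u} [Monoid G] [Field k] {σ : G →* (k →+* k)}
    {H : GroupScheme σ} (X : Rep H) {n : ℕ} (e : Module.Basis (Fin n) k X.V) :
    Matrix.GeneralLinearGroup (Fin n) H.coordRing :=
  Units.map (LinearMap.toMatrixAlgEquiv
      (Algebra.TensorProduct.basis H.coordRing e)).toMulEquiv.toMonoidHom
    ((X.ρ H.coordRing).toHomUnits H.univPoint)

/-- The dual morphism `φ^* : k{GL(V)} → k{H}` of the representation `φ : H → GL(V)`, where `k{GL(V)}`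
is identified with `k{GL_n}` by a basis of `V`: it corresponds to the image of the universal point
of `H` in `GL(V)(k{H})`. -/
def Rep.dualMorphism {G k : Type u} [Monoid G] [Field k] {σ : G →* (k →+* k)}
    {H : GroupScheme σ} (X : Rep H) {n : ℕ} (e : Module.Basis (Fin n) k X.V) :
    glAlg σ n ⟶ H.coordRing :=
  glAlg.homOfPoint (X.univMatrix e)

/-- A representation `φ : H → GL(V)` is faithful if `φ^* : k{GL(V)} → k{H}` is surjective. -/
def Rep.Faithful {G k : Type u} [Monoid G] [Field k] {σ : G →* (k →+* k)}
    {H : GroupScheme σ} (X : Rep H) : Prop :=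
  Function.Surjective (X.dualMorphism (Module.finBasis k X.V)).toAlgHom

/-! ### Tensor generators -/

/-- The representations built from members of `S` by finitely many tensor products (including the
empty one), direct sums and duals. -/
inductive TensorConstruction {G k : Type u} [Monoid G] [Field k] {σ : G →* (k →+* k)}
    {H : GroupScheme σ} (S : Set (Rep H)) : Rep H → Prop
  | of (X : Rep H) (hX : X ∈ S) : TensorConstruction S X
  | unit : TensorConstruction S (Rep.unit H)
  | tensor (X Y : Rep H) (hX : TensorConstruction S X) (hY : TensorConstruction S Y) :
      TensorConstruction S (X.tensor Y)
  | directSum (X Y : Rep H) (hX : TensorConstruction S X) (hY : TensorConstruction S Y) :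
      TensorConstruction S (X.directSum Y)
  | dual (X : Rep H) (hX : TensorConstruction S X) : TensorConstruction S X.dual

/-- `U` is a subquotient of `X`: a quotient of a subobject of `X`. -/
def Rep.IsSubquotient {G k : Type u} [Monoid G] [Field k] {σ : G →* (k →+* k)}
    {H : GroupScheme σ} (U X : Rep H) : Prop :=
  ∃ (Y : Rep H) (i : Rep.Hom Y X) (p : Rep.Hom Y U),
    Function.Injective i.toLinearMap ∧ Function.Surjective p.toLinearMap

/-- `S` generates `Rep(H)` as a (rigid abelian) tensor category: every object is a subquotient of
an object built from members of `S` by tensor products, direct sums and duals. -/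
def TensorGenerates {G k : Type u} [Monoid G] [Field k] {σ : G →* (k →+* k)}
    {H : GroupScheme σ} (S : Set (Rep H)) : Prop :=
  ∀ U : Rep H, ∃ X : Rep H, TensorConstruction S X ∧ U.IsSubquotient X

/-- `X` is a `G`-`⊗`-generator of `Rep(H)`: the objects `T(g)(X)`, `g ∈ G`, generate `Rep(H)` as a
tensor category. -/
def Rep.IsGTensorGenerator {G k : Type u} [Monoid G] [Field k] {σ : G →* (k →+* k)}
    {H : GroupScheme σ} (X : Rep H) : Prop :=
  TensorGenerates (Set.range fun g : G => X.twist g)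

end

end DiffTannaka

namespace DiffTannaka

noncomputable section

variable {G k : Type u} [Monoid G] [Field k] {σ : G →* (k →+* k)}

/-! Write `A` for the algebra `k{H}` and `η` for the universal point in `H(A)`. The proof is the
comodule argument for affine group schemes, carried out on points: the group law of `H` and Yoneda
replace the comultiplication. A linear map `L : Z → N` on a representation gives `coact L : Z → A ⊗
N`, `z ↦ L(η z)`. Its kernel is a subrepresentation (`Rep.isStable_ker_coact`), and for `L = id` it
is injective (`Rep.coact_id_injective`). Suppose that the image of `coact L`, for some `L : W → U`,
contains that of `coact id` on `U`. Then the pairs `(w, u)` with `coact L w = coact id u` form a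
subrepresentation of `W ⊕ U` that embeds in `W` and maps onto `U`, so `U` is a subquotient of `W`
(`Rep.isSubquotient_of_coact`). It remains to find such a `W` among the tensor constructions. Their
matrix coefficients form a subalgebra of `A`: sums come from direct sums, products from tensor
products, constants from the unit (`coefAlgebra`). For the family `T(g)(V)` it contains the images
under `φ^*` of all `x_{ij,g}` and, through duals, of all inverses of `g(det)`. Faithfulness makes it
all of `A` (`Rep.coefAlgebra_eq_top`). Every element of `A ⊗ U` is then a value of some `coact L`,
and a direct sum over a basis of `U` gives `W` (`tensorGenerates_of_coefAlgebra_eq_top`). -/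

/-! ### Tensor products of `k`-`G`-algebras -/

/-- The ring homomorphism `a ⊗ b ↦ f a * g b` attached to ring homomorphisms `f` and `g` which agree
on the base ring. -/
def tensorLift {k R A C : Type*} [CommRing k] [CommRing R] [CommRing A] [CommRing C] [Algebra k R]
    [Algebra k A] (f : R →+* C) (g : A →+* C)
    (hfg : ∀ a, g (algebraMap k A a) = f (algebraMap k R a)) : R ⊗[k] A →+* C :=
  -- In the application `f` and `g` are only semilinear over an endomorphism of `k`. Letting `k` act
  -- on `C` through `f` makes both of them `k`-algebra maps.
  letI : Algebra k C := (f.comp (algebraMap k R)).toAlgebra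
  (Algebra.TensorProduct.lift (R := k) (S := k) (⟨f, fun _ => rfl⟩ : R →ₐ[k] C)
    (⟨g, hfg⟩ : A →ₐ[k] C) (fun _ _ => Commute.all _ _)).toRingHom

@[simp]
lemma tensorLift_tmul {k R A C : Type*} [CommRing k] [CommRing R] [CommRing A] [CommRing C]
    [Algebra k R] [Algebra k A] (f : R →+* C) (g : A →+* C)
    (hfg : ∀ a, g (algebraMap k A a) = f (algebraMap k R a)) (r : R) (a : A) :
    tensorLift f g hfg (r ⊗ₜ a) = f r * g a := rfl

/-- The diagonal action of `g ∈ G` on `R ⊗ A`. -/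
def GAlg.tensorT (R A : GAlg σ) (g : G) : R ⊗[k] A →+* R ⊗[k] A :=
  tensorLift
    ((Algebra.TensorProduct.includeLeft (R := k) (S := k) (A := R) (B := A)).toRingHom.comp (R.T g))
    ((Algebra.TensorProduct.includeRight (R := k) (A := R) (B := A)).toRingHom.comp (A.T g))
    (fun a => by simp [T_algebraMap])

@[simp]
lemma GAlg.tensorT_tmul (R A : GAlg σ) (g : G) (r : R) (a : A) :
    R.tensorT A g (r ⊗ₜ a) = R.T g r ⊗ₜ A.T g a := by
  simp [tensorT]

/-- The tensor product of two `k`-`G`-algebras. -/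
def GAlg.tensor (R A : GAlg σ) : GAlg σ where
  carrier := R ⊗[k] A
  T :=
    { toFun := R.tensorT A
      map_one' := by
        refine RingHom.ext fun (x : R ⊗[k] A) => ?_
        induction x using TensorProduct.induction_on with
        | zero => simp
        | add x y hx hy => rw [map_add, map_add, hx, hy]
        | tmul r a => simp
      map_mul' := fun g h => by
        refine RingHom.ext fun (x : R ⊗[k] A) => ?_
        induction x using TensorProduct.induction_on with
        | zero => simp
        | add x y hx hy => rw [map_add, map_add, hx, hy]
        | tmul r a => simp }
  T_algebraMap g a := by
    change R.tensorT A g (algebraMap k R a ⊗ₜ 1) = algebraMap k R (σ g a) ⊗ₜ 1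
    rw [tensorT_tmul, T_algebraMap, map_one]

/-- The morphism `r ↦ r ⊗ 1`. -/
def GAlg.inl (R A : GAlg σ) : R ⟶ R.tensor A :=
  GAlg.Hom.mk (S := R.tensor A) (Algebra.TensorProduct.includeLeft : R →ₐ[k] R ⊗[k] A)
    (fun g a => by
      change R.T g a ⊗ₜ 1 = R.tensorT A g (a ⊗ₜ 1)
      simp)

/-- The morphism `a ↦ 1 ⊗ a`. -/
def GAlg.inr (R A : GAlg σ) : A ⟶ R.tensor A :=
  GAlg.Hom.mk (S := R.tensor A) (Algebra.TensorProduct.includeRight : A →ₐ[k] R ⊗[k] A)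
    (fun g a => by
      change 1 ⊗ₜ A.T g a = R.tensorT A g (1 ⊗ₜ a)
      simp)

/-! ### The coaction -/

variable {H : GroupScheme σ}

/-- Yoneda. Applied to a product of two points, it does the work of the comultiplication of `k{H}`.
-/
lemma GroupScheme.exists_map_univPoint (H : GroupScheme σ) {R : GAlg σ} (p : H.points.obj R) :
    ∃ f : H.coordRing ⟶ R, H.points.map f H.univPoint = p := by
  refine ⟨H.repr.homEquiv.symm p, ?_⟩
  have := H.repr.homEquiv_eq (H.repr.homEquiv.symm p)
  rw [Equiv.apply_symm_apply] at this
  exact this.symm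

lemma scalarMap_smul {R S : GAlg σ} (f : R ⟶ S) {W : Type u} [AddCommGroup W] [Module k W]
    (r : R) (z : R ⊗[k] W) :
    scalarMap f W (r • z) = GAlg.Hom.toAlgHom f r • scalarMap f W z := by
  induction z using TensorProduct.induction_on with
  | zero => simp
  | add x y hx hy => simp only [smul_add, map_add, hx, hy]
  | tmul r v => simp [TensorProduct.smul_tmul']

lemma scalarMap_baseChange {R S : GAlg σ} (f : R ⟶ S) {V W : Type u} [AddCommGroup V] [Module k V]
    [AddCommGroup W] [Module k W] (L : V →ₗ[k] W) (x : R ⊗[k] V) :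
    scalarMap f W (L.baseChange R x) = L.baseChange S (scalarMap f V x) := by
  induction x using TensorProduct.induction_on with
  | zero => simp
  | add x y hx hy => simp only [map_add, hx, hy]
  | tmul r v => simp

/-- The map `z ↦ L (η z)` from `Z` to `k{H} ⊗ N`, where `η` is the universal point of `H`. -/
def Rep.coact (Z : Rep H) {N : Type u} [AddCommGroup N] [Module k N] (L : Z.V →ₗ[k] N) :
    Z.V →ₗ[k] H.coordRing ⊗[k] N :=
  ((L.baseChange H.coordRing).comp (Z.ρ H.coordRing H.univPoint)).restrictScalars k ∘ₗ
    TensorProduct.mk k H.coordRing Z.V 1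

lemma Rep.coact_apply (Z : Rep H) {N : Type u} [AddCommGroup N] [Module k N] (L : Z.V →ₗ[k] N)
    (z : Z.V) :
    Z.coact L z = L.baseChange H.coordRing (Z.ρ H.coordRing H.univPoint (1 ⊗ₜ z)) := rfl

/-- The associativity isomorphism `R ⊗ (A ⊗ N) ≃ (R ⊗ A) ⊗ N`. -/
def GAlg.assocInv (R A : GAlg σ) (N : Type u) [AddCommGroup N] [Module k N] :
    R ⊗[k] (A ⊗[k] N) ≃ₗ[k] (R.tensor A) ⊗[k] N :=
  (TensorProduct.assoc k R A N).symm

/-- Expresses associativity through the two coprojections into `R ⊗ A`, so that naturality of the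
action can be applied along each of them. -/
lemma GAlg.assocInv_tmul (R A : GAlg σ) {N : Type u} [AddCommGroup N] [Module k N] (r : R)
    (x : A ⊗[k] N) :
    R.assocInv A N (r ⊗ₜ x) = GAlg.Hom.toAlgHom (R.inl A) r • scalarMap (R.inr A) N x := by
  induction x using TensorProduct.induction_on with
  | zero => simp
  | add x y hx hy => rw [TensorProduct.tmul_add, map_add, hx, hy, map_add, smul_add]
  | tmul a n =>
    rw [scalarMap_tmul, TensorProduct.smul_tmul']
    change (r ⊗ₜ[k] a) ⊗ₜ[k] n = ((r ⊗ₜ[k] (1 : A)) * ((1 : R) ⊗ₜ[k] a)) ⊗ₜ[k] n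
    simp

/-- Over `R ⊗ k{H}`, applying the coaction after base change to `R` is the action of the image of
`η`. For `y = h(1 ⊗ z)` the right-hand side thus involves the product of the images of `η` and `h`.
-/
lemma Rep.assocInv_coact (Z : Rep H) {N : Type u} [AddCommGroup N] [Module k N]
    (L : Z.V →ₗ[k] N) (R : GAlg σ) (y : R ⊗[k] Z.V) :
    R.assocInv H.coordRing N ((Z.coact L).baseChange R y) =
      L.baseChange (R.tensor H.coordRing) (Z.ρ (R.tensor H.coordRing)
        (H.points.map (R.inr H.coordRing) H.univPoint) (scalarMap (R.inl H.coordRing) Z.V y)) := by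
  induction y using TensorProduct.induction_on with
  | zero => simp
  | add x y hx hy => simp only [map_add, hx, hy]
  | tmul r z =>
    have e : r ⊗ₜ[k] z = r • ((1 : R) ⊗ₜ[k] z) := by simp [TensorProduct.smul_tmul']
    rw [LinearMap.baseChange_tmul, GAlg.assocInv_tmul, coact_apply, scalarMap_baseChange, Z.natural, e,
      scalarMap_smul, map_smul, map_smul, scalarMap_tmul, scalarMap_tmul, map_one, map_one]

lemma Rep.coact_baseChange_eq_zero (Z : Rep H) {N : Type u} [AddCommGroup N] [Module k N]
    (L : Z.V →ₗ[k] N) {z : Z.V} (hz : Z.coact L z = 0) (R : GAlg σ) (h : H.points.obj R) :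
    (Z.coact L).baseChange R (Z.ρ R h (1 ⊗ₜ z)) = 0 := by
  apply (R.assocInv H.coordRing N).injective
  -- The product of the images of `η` and `h` in `H(R ⊗ k{H})` is itself the image of `η` under some
  -- `q`. The element in question is therefore the image under `q` of `coact L z = 0`.
  obtain ⟨q, hq⟩ := H.exists_map_univPoint
    (H.points.map (R.inr H.coordRing) H.univPoint * H.points.map (R.inl H.coordRing) h)
  rw [Z.assocInv_coact, Z.natural, ← Module.End.mul_apply, ← map_mul, ← hq, scalarMap_tmul,
    map_one, ← map_one (GAlg.Hom.toAlgHom q), ← scalarMap_tmul, ← Z.natural,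
    ← scalarMap_baseChange, ← coact_apply, hz, map_zero, map_zero]

/-! ### Subrepresentations -/

/-- `K` is a subrepresentation of `Z`: every `h ∈ H(R)` preserves `R ⊗ K`. -/
def Rep.IsStable (Z : Rep H) (K : Submodule k Z.V) : Prop :=
  ∀ (R : GAlg σ) (h : H.points.obj R) (x : R ⊗[k] K),
    Z.ρ R h (K.subtype.baseChange R x) ∈ LinearMap.range (K.subtype.baseChange R)

lemma baseChange_subtype_injective {V : Type u} [AddCommGroup V] [Module k V] (K : Submodule k V)
    (R : Type u) [CommRing R] [Algebra k R] :
    Function.Injective (K.subtype.baseChange R) :=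
  Module.Flat.lTensor_preserves_injective_linearMap (M := R) K.subtype K.injective_subtype

/-- The action of `h` on `R ⊗ K` for a subrepresentation `K`. -/
def Rep.subAct (Z : Rep H) {K : Submodule k Z.V} (hK : Z.IsStable K) (R : GAlg σ)
    (h : H.points.obj R) : Module.End R (R ⊗[k] K) :=
  (LinearEquiv.ofInjective _ (baseChange_subtype_injective K R)).symm.toLinearMap ∘ₗ
    ((Z.ρ R h).comp (K.subtype.baseChange R)).codRestrict _ (hK R h)

lemma Rep.baseChange_subAct (Z : Rep H) {K : Submodule k Z.V} (hK : Z.IsStable K) (R : GAlg σ)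
    (h : H.points.obj R) (x : R ⊗[k] K) :
    K.subtype.baseChange R (Z.subAct hK R h x) = Z.ρ R h (K.subtype.baseChange R x) := by
  have := LinearEquiv.ofInjective_apply (h := baseChange_subtype_injective K R)
    (K.subtype.baseChange R) (Z.subAct hK R h x)
  rw [← this]
  simp [subAct]

/-- A subrepresentation as a representation. -/
def Rep.sub (Z : Rep H) {K : Submodule k Z.V} (hK : Z.IsStable K) : Rep H where
  V := K
  ρ R :=
    { toFun := Z.subAct hK R
      map_one' := by
        apply LinearMap.ext
        intro x
        apply baseChange_subtype_injective K R
        simp [baseChange_subAct]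
      map_mul' := fun g h => by
        apply LinearMap.ext
        intro x
        apply baseChange_subtype_injective K R
        simp [baseChange_subAct] }
  natural {R S} f h x := by
    apply baseChange_subtype_injective K S
    change K.subtype.baseChange S (scalarMap f K (Z.subAct hK R h x)) =
      K.subtype.baseChange S (Z.subAct hK S (H.points.map f h) (scalarMap f K x))
    rw [← scalarMap_baseChange, baseChange_subAct, baseChange_subAct, Z.natural,
      scalarMap_baseChange]

/-- The inclusion of a subrepresentation. -/
def Rep.subHom (Z : Rep H) {K : Submodule k Z.V} (hK : Z.IsStable K) : Rep.Hom (Z.sub hK) Z where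
  toLinearMap := K.subtype
  equivariant R h x := Z.baseChange_subAct hK R h x

/-- Composition of morphisms of representations. -/
def Rep.Hom.comp {X Y Z : Rep H} (g : Rep.Hom Y Z) (f : Rep.Hom X Y) : Rep.Hom X Z where
  toLinearMap := g.toLinearMap ∘ₗ f.toLinearMap
  equivariant R h x := by
    rw [LinearMap.baseChange_comp, LinearMap.comp_apply, LinearMap.comp_apply, f.equivariant,
      g.equivariant]

/-- By flatness over `k`, `R ⊗ ker` is the kernel of the base-changed map, so stability reduces to
`Rep.coact_baseChange_eq_zero` on the vectors `1 ⊗ z`. -/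
lemma Rep.isStable_ker_coact (Z : Rep H) {N : Type u} [AddCommGroup N] [Module k N]
    (L : Z.V →ₗ[k] N) : Z.IsStable (LinearMap.ker (Z.coact L)) := by
  intro R h x
  have ex : Function.Exact ((LinearMap.ker (Z.coact L)).subtype.lTensor R)
      ((Z.coact L).lTensor R) :=
    Module.Flat.lTensor_exact R (LinearMap.exact_subtype_ker_map (Z.coact L))
  refine (ex _).1 ?_
  change (Z.coact L).baseChange R _ = 0
  induction x using TensorProduct.induction_on with
  | zero => simp
  | add x y hx hy => rw [map_add, map_add, map_add, hx, hy, add_zero]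
  | tmul r z =>
    have e : r ⊗ₜ[k] z.1 = r • ((1 : R) ⊗ₜ[k] z.1) := by simp [TensorProduct.smul_tmul']
    rw [LinearMap.baseChange_tmul, Submodule.subtype_apply, e, map_smul, map_smul,
      Z.coact_baseChange_eq_zero L z.2, smul_zero]

/-! ### Direct sums and the subquotient criterion -/

/-- The first projection of a direct sum. -/
def Rep.fst (X Y : Rep H) : Rep.Hom (X.directSum Y) X where
  toLinearMap := LinearMap.fst k X.V Y.V
  equivariant R h x := by
    have key : ∀ z, (LinearMap.fst k X.V Y.V).baseChange R z =
        (TensorProduct.prodRight k R R X.V Y.V z).1 := by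
      intro z
      induction z using TensorProduct.induction_on with
      | zero => simp
      | add x y hx hy => simp [hx, hy]
      | tmul r z => simp
    refine (key _).trans (Eq.trans ?_ (congrArg (X.ρ R h) (key x).symm))
    exact congrArg Prod.fst (LinearEquiv.apply_symm_apply (TensorProduct.prodRight k R R X.V Y.V)
      (((X.ρ R).prod (Y.ρ R)) h (TensorProduct.prodRight k R R X.V Y.V x)))

/-- The second projection of a direct sum. -/
def Rep.snd (X Y : Rep H) : Rep.Hom (X.directSum Y) Y where
  toLinearMap := LinearMap.snd k X.V Y.V
  equivariant R h x := by
    have key : ∀ z, (LinearMap.snd k X.V Y.V).baseChange R z =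
        (TensorProduct.prodRight k R R X.V Y.V z).2 := by
      intro z
      induction z using TensorProduct.induction_on with
      | zero => simp
      | add x y hx hy => simp [hx, hy]
      | tmul r z => simp
    refine (key _).trans (Eq.trans ?_ (congrArg (Y.ρ R h) (key x).symm))
    exact congrArg Prod.snd (LinearEquiv.apply_symm_apply (TensorProduct.prodRight k R R X.V Y.V)
      (((X.ρ R).prod (Y.ρ R)) h (TensorProduct.prodRight k R R X.V Y.V x)))

lemma Rep.coact_comp_hom {X Y : Rep H} (f : Rep.Hom X Y) {N : Type u} [AddCommGroup N] [Module k N]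
    (L : Y.V →ₗ[k] N) (x : X.V) :
    X.coact (L ∘ₗ f.toLinearMap) x = Y.coact L (f.toLinearMap x) := by
  rw [coact_apply, LinearMap.baseChange_comp, LinearMap.comp_apply, f.equivariant,
    LinearMap.baseChange_tmul, coact_apply]

lemma Rep.coact_sub (Z : Rep H) {N : Type u} [AddCommGroup N] [Module k N] (L L' : Z.V →ₗ[k] N)
    (z : Z.V) : Z.coact (L - L') z = Z.coact L z - Z.coact L' z := by
  simp [coact_apply, LinearMap.baseChange_sub]

lemma Rep.coact_add (Z : Rep H) {N : Type u} [AddCommGroup N] [Module k N] (L L' : Z.V →ₗ[k] N)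
    (z : Z.V) : Z.coact (L + L') z = Z.coact L z + Z.coact L' z := by
  simp [coact_apply, LinearMap.baseChange_add]

/-- The field `k` as a `k`-`G`-algebra. -/
def GAlg.base (σ : G →* (k →+* k)) : GAlg σ where
  carrier := k
  T := σ
  T_algebraMap _ _ := rfl

/-- The identity element of `H(k)` corresponds to a morphism from `k{H}` to the nonzero ring `k`. -/
lemma GroupScheme.nontrivial_coordRing (H : GroupScheme σ) : Nontrivial H.coordRing := by
  obtain ⟨f, -⟩ := H.exists_map_univPoint (1 : H.points.obj (GAlg.base σ))
  have : Nontrivial (GAlg.base σ) := inferInstanceAs (Nontrivial k)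
  exact (GAlg.Hom.toAlgHom f).toRingHom.domain_nontrivial

/-- `η` acts bijectively, and `u ↦ 1 ⊗ u` is injective because a nonzero algebra over a field is
faithfully flat. -/
lemma Rep.coact_id_injective (U : Rep H) : Function.Injective (U.coact LinearMap.id) := by
  intro u v huv
  have := H.nontrivial_coordRing
  rw [coact_apply, coact_apply, LinearMap.baseChange_id] at huv
  have h := (U.ρ H.coordRing).apply_bijective H.univPoint |>.injective huv
  exact Module.FaithfullyFlat.tensorProduct_mk_injective U.V h

/-- If the image of the coaction of `U` is contained in that of `coact L` for a map `L : W → U`,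
then `U` is a subquotient of `W`. -/
lemma Rep.isSubquotient_of_coact (U W : Rep H) (L : W.V →ₗ[k] U.V)
    (hL : ∀ u, ∃ w, W.coact L w = U.coact LinearMap.id u) : U.IsSubquotient W := by
  -- `D(w, u) = L w - u`, so that the kernel of `coact D` is the fibre product of `coact L` and
  -- `coact id`.
  let D : (W.directSum U).V →ₗ[k] U.V :=
    L ∘ₗ (W.fst U).toLinearMap - LinearMap.id ∘ₗ (W.snd U).toLinearMap
  have hD : ∀ z, (W.directSum U).coact D z = 0 ↔ W.coact L z.1 = U.coact LinearMap.id z.2 := by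
    intro z
    rw [coact_sub, coact_comp_hom, coact_comp_hom, sub_eq_zero]
    rfl
  have hK := (W.directSum U).isStable_ker_coact D
  refine ⟨(W.directSum U).sub hK, (W.fst U).comp ((W.directSum U).subHom hK),
    (W.snd U).comp ((W.directSum U).subHom hK), ?_, ?_⟩
  -- On this fibre product `w` determines `coact id u`, hence `u`.
  · rintro ⟨⟨w, u⟩, hz⟩ ⟨⟨w', u'⟩, hz'⟩ (rfl : w = w')
    have h1 := (hD _).1 hz
    have h2 := (hD _).1 hz'
    obtain rfl : u = u' := U.coact_id_injective (h1.symm.trans h2)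
    rfl
  · intro u
    obtain ⟨w, hw⟩ := hL u
    exact ⟨⟨(w, u), (hD (w, u)).2 hw⟩, rfl⟩

/-! ### Matrix coefficients -/

/-- The `R`-linear extension `R ⊗ V → R` of a linear form `l` on `V`. -/
def evalForm (R : Type u) [CommRing R] [Algebra k R] {V : Type u} [AddCommGroup V] [Module k V]
    (l : Module.Dual k V) : R ⊗[k] V →ₗ[R] R :=
  (Algebra.linearMap k R ∘ₗ l).liftBaseChange R

@[simp]
lemma evalForm_tmul (R : Type u) [CommRing R] [Algebra k R] {V : Type u} [AddCommGroup V]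
    [Module k V] (l : Module.Dual k V) (r : R) (v : V) :
    evalForm R l (r ⊗ₜ v) = r * algebraMap k R (l v) := rfl

/-- Rank-one maps turn matrix coefficients into pure tensors: this is how a prescribed `a ⊗ n` is
later obtained as a value of a coaction. -/
lemma baseChange_smulRight (R : Type u) [CommRing R] [Algebra k R] {V N : Type u} [AddCommGroup V]
    [Module k V] [AddCommGroup N] [Module k N] (l : Module.Dual k V) (n : N) (x : R ⊗[k] V) :
    (l.smulRight n).baseChange R x = evalForm R l x ⊗ₜ n := by
  induction x using TensorProduct.induction_on with
  | zero => simp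
  | add x y hx hy => rw [map_add, map_add, hx, hy, TensorProduct.add_tmul]
  | tmul r v =>
    rw [LinearMap.baseChange_tmul, LinearMap.smulRight_apply, evalForm_tmul,
      ← TensorProduct.smul_tmul, Algebra.smul_def, mul_comm]

/-- The matrix coefficient `l (η v)` of `Y`, where `η` is the universal point of `H`. -/
def Rep.coef (Y : Rep H) (l : Module.Dual k Y.V) (v : Y.V) : H.coordRing :=
  evalForm H.coordRing l (Y.ρ H.coordRing H.univPoint (1 ⊗ₜ v))

lemma Rep.coact_smulRight (Y : Rep H) {N : Type u} [AddCommGroup N] [Module k N]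
    (l : Module.Dual k Y.V) (n : N) (v : Y.V) :
    Y.coact (l.smulRight n) v = Y.coef l v ⊗ₜ n :=
  baseChange_smulRight _ l n _

lemma Rep.coef_smul (Y : Rep H) (l : Module.Dual k Y.V) (a : k) (v : Y.V) :
    Y.coef l (a • v) = a • Y.coef l v := by
  have e : (1 : H.coordRing) ⊗ₜ[k] (a • v) = (algebraMap k H.coordRing a) • (1 ⊗ₜ v) := by
    rw [algebraMap_smul, TensorProduct.tmul_smul]
  rw [coef, e, map_smul, map_smul, algebraMap_smul, coef]

lemma Rep.coef_unit : (Rep.unit H).coef LinearMap.id (1 : k) = 1 := by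
  change evalForm H.coordRing (LinearMap.id : k →ₗ[k] k) (1 ⊗ₜ 1) = 1
  simp

lemma Rep.coef_directSum (X Y : Rep H) (l : Module.Dual k X.V) (m : Module.Dual k Y.V) (x : X.V)
    (y : Y.V) : (X.directSum Y).coef (l.coprod m) (x, y) = X.coef l x + Y.coef m y := by
  have key : ∀ z, evalForm H.coordRing (l.coprod m) ((TensorProduct.prodRight k H.coordRing
      H.coordRing X.V Y.V).symm z) = evalForm H.coordRing l z.1 + evalForm H.coordRing m z.2 := by
    intro z
    obtain ⟨w, rfl⟩ := (TensorProduct.prodRight k H.coordRing H.coordRing X.V Y.V).surjective z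
    rw [LinearEquiv.symm_apply_apply]
    induction w using TensorProduct.induction_on with
    | zero => simp
    | add x y hx hy => simp only [map_add, hx, hy, Prod.fst_add, Prod.snd_add]; ring
    | tmul r z => simp [mul_add]
  exact key _

lemma Rep.coef_tensor (X Y : Rep H) (l : Module.Dual k X.V) (m : Module.Dual k Y.V) (x : X.V)
    (y : Y.V) : (X.tensor Y).coef (LinearMap.mul' k k ∘ₗ TensorProduct.map l m) (x ⊗ₜ y) =
      X.coef l x * Y.coef m y := by
  have key : ∀ (a : H.coordRing ⊗[k] X.V) (b : H.coordRing ⊗[k] Y.V),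
      evalForm H.coordRing (LinearMap.mul' k k ∘ₗ TensorProduct.map l m)
        ((AlgebraTensorModule.distribBaseChange k H.coordRing X.V Y.V).symm (a ⊗ₜ b)) =
      evalForm H.coordRing l a * evalForm H.coordRing m b := by
    intro a b
    induction a using TensorProduct.induction_on with
    | zero => simp
    | add a a' ha ha' => simp only [TensorProduct.add_tmul, map_add, ha, ha', add_mul]
    | tmul r v =>
      induction b using TensorProduct.induction_on with
      | zero => simp
      | add b b' hb hb' => simp only [TensorProduct.tmul_add, map_add, hb, hb', mul_add]
      | tmul r' w => simp; ring
  refine Eq.trans ?_ (key _ _)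
  change evalForm H.coordRing (LinearMap.mul' k k ∘ₗ TensorProduct.map l m)
    ((AlgebraTensorModule.distribBaseChange k H.coordRing X.V Y.V).symm
      ((X.ρ H.coordRing).tprod (Y.ρ H.coordRing) H.univPoint
        (AlgebraTensorModule.distribBaseChange k H.coordRing X.V Y.V (1 ⊗ₜ (x ⊗ₜ y))))) = _
  simp

/-- Coefficients of the dual are those of the inverse of `η`; they supply the inverses of the
determinants. -/
lemma Rep.coef_dual (X : Rep H) (x : X.V) (l : Module.Dual k X.V) :
    X.dual.coef (Module.Dual.eval k X.V x) l =
      evalForm H.coordRing l (X.ρ H.coordRing H.univPoint⁻¹ (1 ⊗ₜ x)) := by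
  have key : ∀ z, evalForm H.coordRing (Module.Dual.eval k X.V x) z =
      dualEquiv H.coordRing X.V z (1 ⊗ₜ x) := by
    intro z
    induction z using TensorProduct.induction_on with
    | zero => simp
    | add x y hx hy => simp only [map_add, hx, hy, LinearMap.add_apply]
    | tmul r m => simp [dualEquiv_tmul_tmul]
  have key' : ∀ w, dualEquiv H.coordRing X.V (1 ⊗ₜ l) w = evalForm H.coordRing l w := by
    intro w
    induction w using TensorProduct.induction_on with
    | zero => simp
    | add x y hx hy => simp only [map_add, hx, hy]
    | tmul r m => simp [dualEquiv_tmul_tmul]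
  refine (key _).trans ?_
  rw [← key']
  change dualEquiv H.coordRing X.V ((dualEquiv H.coordRing X.V).symm
    ((X.ρ H.coordRing).dual H.univPoint (dualEquiv H.coordRing X.V (1 ⊗ₜ l)))) (1 ⊗ₜ x) = _
  rw [LinearEquiv.apply_symm_apply, Representation.dual_apply, Module.Dual.transpose_apply]
  rfl

/-- The linear form on `ᵍV` obtained from a linear form on `V` by base extension. -/
def twistForm (s : k →+* k) {V : Type u} [AddCommGroup V] [Module k V] (l : Module.Dual k V) :
    Module.Dual k (Twist s V) :=
  Twist.lift s
    { toFun := fun v => s (l v)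
      map_add' := fun v w => by simp
      map_smul' := fun a v => by simp }

lemma twistForm_mk (s : k →+* k) {V : Type u} [AddCommGroup V] [Module k V] (l : Module.Dual k V)
    (v : V) : twistForm s l (Twist.mk s V v) = s (l v) := by
  simp [twistForm]

/-- Twisting a representation by `g` applies `T(g)` to its matrix coefficients. This is where the
action of `G` on `k{H}` meets the objects `T(g)(X)`. -/
lemma Rep.evalForm_twist (X : Rep H) (g : G) (R : GAlg σ) (h : H.points.obj R)
    (l : Module.Dual k X.V) (v : X.V) :
    evalForm R (twistForm (σ g) l) ((X.twist g).ρ R h (1 ⊗ₜ Twist.mk (σ g) X.V v)) =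
      R.T g (evalForm R l (X.ρ R h (1 ⊗ₜ v))) := by
  have key : ∀ z, evalForm R (twistForm (σ g) l) (twistMap g R X.V z) =
      R.T g (evalForm R l z) := by
    intro z
    induction z using TensorProduct.induction_on with
    | zero => simp
    | add x y hx hy => simp only [map_add, hx, hy]
    | tmul r v => simp [twistForm_mk, R.T_algebraMap]
  rw [← key, ← twistEnd_mk]
  rfl

/-! ### The algebra of matrix coefficients -/

/-- The matrix coefficients of the representations built from members of `S`. -/
def coefAlgebra (S : Set (Rep H)) : Subalgebra k H.coordRing where
  carrier := {a | ∃ Y : Rep H, TensorConstruction S Y ∧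
    ∃ (l : Module.Dual k Y.V) (v : Y.V), Y.coef l v = a}
  mul_mem' := by
    rintro _ _ ⟨X, hX, l, x, rfl⟩ ⟨Y, hY, m, y, rfl⟩
    exact ⟨_, .tensor X Y hX hY, _, _, X.coef_tensor Y l m x y⟩
  add_mem' := by
    rintro _ _ ⟨X, hX, l, x, rfl⟩ ⟨Y, hY, m, y, rfl⟩
    exact ⟨_, .directSum X Y hX hY, _, _, X.coef_directSum Y l m x y⟩
  algebraMap_mem' a := by
    refine ⟨_, .unit, (LinearMap.id : k →ₗ[k] k), a • (1 : k), ?_⟩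
    rw [Algebra.algebraMap_eq_smul_one, ← Rep.coef_unit]
    exact (Rep.unit H).coef_smul _ _ _

variable (X : Rep H)

lemma Rep.T_coef_mem (g : G) (l : Module.Dual k X.V) (v : X.V) :
    H.coordRing.T g (X.coef l v) ∈ coefAlgebra (Set.range fun g : G => X.twist g) :=
  ⟨X.twist g, .of _ ⟨g, rfl⟩, _, _, X.evalForm_twist g _ _ l v⟩

lemma Rep.T_coef_inv_mem (g : G) (l : Module.Dual k X.V) (v : X.V) :
    H.coordRing.T g (evalForm H.coordRing l (X.ρ H.coordRing H.univPoint⁻¹ (1 ⊗ₜ v))) ∈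
      coefAlgebra (Set.range fun g : G => X.twist g) := by
  refine ⟨(X.twist g).dual, .dual _ (.of _ ⟨g, rfl⟩),
    Module.Dual.eval k _ (Twist.mk (σ g) X.V v), twistForm (σ g) l, ?_⟩
  rw [← X.evalForm_twist]
  exact (X.twist g).coef_dual _ _

lemma evalForm_coord (R : Type u) [CommRing R] [Algebra k R] {V : Type u} [AddCommGroup V]
    [Module k V] {n : ℕ} (e : Module.Basis (Fin n) k V) (i : Fin n) (x : R ⊗[k] V) :
    evalForm R (e.coord i) x = (Algebra.TensorProduct.basis R e).repr x i := by
  induction x using TensorProduct.induction_on with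
  | zero => simp
  | add x y hx hy => simp only [map_add, hx, hy, Finsupp.add_apply]
  | tmul r v => simp

lemma Rep.univMatrix_apply {n : ℕ} (e : Module.Basis (Fin n) k X.V) (i j : Fin n) :
    (X.univMatrix e).1 i j = X.coef (e.coord i) (e j) := by
  rw [coef, evalForm_coord, ← Algebra.TensorProduct.basis_apply]
  exact LinearMap.toMatrixAlgEquiv_apply _ _ _ _

lemma Rep.univMatrix_inv_apply {n : ℕ} (e : Module.Basis (Fin n) k X.V) (i j : Fin n) :
    (X.univMatrix e)⁻¹.1 i j =
      evalForm H.coordRing (e.coord i) (X.ρ H.coordRing H.univPoint⁻¹ (1 ⊗ₜ e j)) := by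
  rw [evalForm_coord, ← Algebra.TensorProduct.basis_apply, univMatrix, ← map_inv, ← map_inv]
  exact LinearMap.toMatrixAlgEquiv_apply _ _ _ _

lemma Subalgebra.det_mem {A : Type*} [CommRing A] [Algebra k A] (B : Subalgebra k A) {n : ℕ}
    (M : Matrix (Fin n) (Fin n) A) (hM : ∀ i j, M i j ∈ B) : M.det ∈ B := by
  have e : M = B.val.mapMatrix (Matrix.of fun i j => (⟨M i j, hM i j⟩ : B)) := by
    ext i j; rfl
  rw [e, ← AlgHom.map_det]
  exact Subtype.property _

lemma Rep.aeval_mem {n : ℕ} (e : Module.Basis (Fin n) k X.V) (f : GPoly G k n) :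
    MvPolynomial.aeval (R := k)
      (fun p : Fin n × Fin n × G => H.coordRing.T p.2.2 ((X.univMatrix e).1 p.1 p.2.1)) f ∈
      coefAlgebra (Set.range fun g : G => X.twist g) := by
  induction f using MvPolynomial.induction_on with
  | C a => rw [MvPolynomial.aeval_C]; exact Subalgebra.algebraMap_mem _ a
  | add p q hp hq => rw [map_add]; exact add_mem hp hq
  | mul_X p i hp =>
    rw [map_mul, MvPolynomial.aeval_X, univMatrix_apply]
    exact mul_mem hp (X.T_coef_mem _ _ _)

lemma Rep.exists_inv_mem {n : ℕ} (e : Module.Basis (Fin n) k X.V) {s : GPoly G k n}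
    (hs : s ∈ GPoly.dets G k n) :
    ∃ b ∈ coefAlgebra (Set.range fun g : G => X.twist g), MvPolynomial.aeval (R := k)
      (fun p : Fin n × Fin n × G => H.coordRing.T p.2.2 ((X.univMatrix e).1 p.1 p.2.1)) s * b =
        1 := by
  induction hs using Submonoid.closure_induction with
  | one => exact ⟨1, one_mem _, by simp⟩
  | mul x y _ _ hx hy =>
    obtain ⟨b, hb, h1⟩ := hx
    obtain ⟨c, hc, h2⟩ := hy
    exact ⟨b * c, mul_mem hb hc, by rw [map_mul, mul_mul_mul_comm, h1, h2, one_mul]⟩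
  | mem x hx =>
    obtain ⟨g, rfl⟩ := hx
    -- The inverse of `g(det M)` is `det(g(M⁻¹))`, a polynomial in the entries of `g(M⁻¹)`, which
    -- are coefficients of the dual of `T(g)(X)`.
    refine ⟨((H.coordRing.T g).mapMatrix (X.univMatrix e)⁻¹.1).det,
      Subalgebra.det_mem _ _ fun i j => ?_, ?_⟩
    · rw [RingHom.mapMatrix_apply, Matrix.map_apply, univMatrix_inv_apply]
      exact X.T_coef_inv_mem _ _ _
    · have h : MvPolynomial.aeval (R := k)
          (fun p : Fin n × Fin n × G => H.coordRing.T p.2.2 ((X.univMatrix e).1 p.1 p.2.1))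
            (GPoly.det G k n g) = ((H.coordRing.T g).mapMatrix (X.univMatrix e).1).det := by
        unfold GPoly.det
        rw [AlgHom.map_det]
        congr 1
        ext1 i j
        simp
      rw [h, ← Matrix.det_mul, ← map_mul, Units.mul_inv, map_one, Matrix.det_one]

lemma Rep.coefAlgebra_eq_top (hX : X.Faithful) :
    coefAlgebra (Set.range fun g : G => X.twist g) = ⊤ := by
  refine eq_top_iff.2 fun a _ => ?_
  obtain ⟨z, rfl⟩ := hX a
  let e := Module.finBasis k X.V
  -- An element of `k{GL_n}` is a fraction `f/s` with `s` a product of determinants. Its image is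
  -- the image of `f` times the inverse `b` of the image of `s`.
  obtain ⟨f, s, rfl⟩ := IsLocalization.exists_mk'_eq (GPoly.dets G k (Module.finrank k X.V))
    (show GLRing G k (Module.finrank k X.V) from z)
  obtain ⟨b, hb, h⟩ := X.exists_inv_mem e s.2
  have h1 := congrArg (GLRing.liftPoint (X.univMatrix e))
    (IsLocalization.mk'_spec (GLRing G k (Module.finrank k X.V)) f s)
  rw [map_mul, GLRing.liftPoint_algebraMap, GLRing.liftPoint_algebraMap] at h1
  have h2 := congrArg (· * b) h1
  simp only [mul_assoc, h, mul_one] at h2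
  change GLRing.liftPoint (X.univMatrix e) _ ∈ _
  rw [h2]
  exact mul_mem (X.aeval_mem e f) hb

/-! ### Generation -/

lemma Rep.coact_directSum_coprod (Y Z : Rep H) {N : Type u} [AddCommGroup N] [Module k N]
    (L : Y.V →ₗ[k] N) (M : Z.V →ₗ[k] N) (y : Y.V) (z : Z.V) :
    (Y.directSum Z).coact (L.coprod M) (y, z) = Y.coact L y + Z.coact M z := by
  refine ((Y.directSum Z).coact_add (L ∘ₗ (Y.fst Z).toLinearMap) (M ∘ₗ (Y.snd Z).toLinearMap)
    (y, z)).trans ?_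
  exact congrArg₂ _ (coact_comp_hom (Y.fst Z) L (y, z)) (coact_comp_hom (Y.snd Z) M (y, z))

/-- If every element of `k{H}` is a matrix coefficient of a representation built from `S`, then
every element of `k{H} ⊗ N` is a value of `coact L` for some `L : W → N`, where `W` is built
from `S`. -/
lemma exists_coact_eq {S : Set (Rep H)} (hS : coefAlgebra S = ⊤) {N : Type u} [AddCommGroup N]
    [Module k N] (x : H.coordRing ⊗[k] N) :
    ∃ W : Rep H, TensorConstruction S W ∧ ∃ (L : W.V →ₗ[k] N) (w : W.V), W.coact L w = x := by
  induction x using TensorProduct.induction_on with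
  | zero => exact ⟨_, .unit, 0, 0, map_zero _⟩
  | add x y hx hy =>
    obtain ⟨Y, hY, L, y, rfl⟩ := hx
    obtain ⟨Z, hZ, M, z, rfl⟩ := hy
    exact ⟨_, .directSum Y Z hY hZ, L.coprod M, (y, z), Y.coact_directSum_coprod Z L M y z⟩
  | tmul a n =>
    obtain ⟨Y, hY, l, v, rfl⟩ : a ∈ coefAlgebra S := hS ▸ Algebra.mem_top
    exact ⟨Y, hY, l.smulRight n, v, Y.coact_smulRight l n v⟩

/-- Direct sums put finitely many prescribed values into the range of a single coaction, each value
coming from its own summand. -/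
lemma exists_coact_range {S : Set (Rep H)} (hS : coefAlgebra S = ⊤) {N : Type u} [AddCommGroup N]
    [Module k N] (s : Finset (H.coordRing ⊗[k] N)) :
    ∃ W : Rep H, TensorConstruction S W ∧ ∃ L : W.V →ₗ[k] N,
      ∀ x ∈ s, x ∈ LinearMap.range (W.coact L) := by
  classical
  induction s using Finset.induction_on with
  | empty => exact ⟨_, .unit, 0, by simp⟩
  | insert a s _ ih =>
    obtain ⟨Y, hY, L, hL⟩ := ih
    obtain ⟨Z, hZ, M, z, hz⟩ := exists_coact_eq hS a
    refine ⟨_, .directSum Y Z hY hZ, L.coprod M, fun x hx => ?_⟩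
    rcases Finset.mem_insert.1 hx with rfl | hx
    · exact ⟨(0, z), by rw [Rep.coact_directSum_coprod, map_zero, zero_add, hz]⟩
    · obtain ⟨y, hy⟩ := hL x hx
      exact ⟨(y, 0), by rw [Rep.coact_directSum_coprod, map_zero, add_zero, hy]⟩

lemma tensorGenerates_of_coefAlgebra_eq_top {S : Set (Rep H)} (hS : coefAlgebra S = ⊤) :
    TensorGenerates S := by
  classical
  intro U
  let e := Module.finBasis k U.V
  obtain ⟨W, hW, L, hL⟩ := exists_coact_range hS
    (Finset.univ.image fun i => U.coact LinearMap.id (e i))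
  refine ⟨W, hW, U.isSubquotient_of_coact W L fun u => ?_⟩
  change U.coact LinearMap.id u ∈ LinearMap.range (W.coact L)
  -- The range of `W.coact L` is a `k`-subspace, so it is enough that it contains the images of a
  -- basis of `U`.
  rw [← e.sum_repr u, map_sum]
  refine Submodule.sum_mem _ fun i _ => ?_
  rw [map_smul]
  exact Submodule.smul_mem _ _ (hL _ (Finset.mem_image_of_mem _ (Finset.mem_univ i)))

end
end DiffTannaka

theorem theorem3p21 {G k : Type u} [Monoid G] [Field k] (σ : G →* (k →+* k))
    (H : DiffTannaka.GroupScheme σ) (hH : H.IsGAlgebraic)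
    (X : DiffTannaka.Rep H) (hX : X.Faithful) :
    X.IsGTensorGenerator :=
  DiffTannaka.tensorGenerates_of_coefAlgebra_eq_top (X.coefAlgebra_eq_top hX)
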